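/- Let $M\ge 1$ and $q\ge 2$ be integers, let $\theta_0,\dots,\theta_{q-1}$ be non-negative integers, and let $p_{S_1},\dots,p_{S_M}$ be probability mass functions on $\{0,\dots,q-1\}$. Let $S_1,\dots,S_M$ be independent random variables, $S_i$ having law $p_{S_i}$. Given $\ell\in\{0,\dots,q-1\}$ and an ordered partition $\mathcal A_1^{(\ell)},\dots,\mathcal A_{J_\ell}^{(\ell)}$ of $\{1,\dots,M\}$ into non-empty, pairwise disjoint sets, define the descriptions $U^{(\ell)}_{[1:J_\ell]}=(U_1^{(\ell)},\dots,U_{J_\ell}^{(\ell)})$ by $U_0^{(\ell)}=0$ and $$U_m^{(\ell)} = U_{m-1}^{(\ell)} + \sum_{i\in\mathcal A_m^{(\ell)}} \mathbf 1_{\{U_{m-1}^{(\ell)}<\theta_\ell\}\cap\{S_i=\ell\}},\qquad 1\le m\le J_\ell .$$ Let $\log$ be the logarithm to base two and $H$ the (joint) Shannon entropy in bits. Then one can choose, for each $\ell\in\{0,\dots,q-1\}$, such a partition (depending only on $M$, $q$, the $\theta$'s and the $p_{S_i}$) so that $$H\big(U^{(\ell)}_{[1:J_\ell]}\big) < \tfrac52\log(1+\theta_\ell)+12\qquad\text{for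 every }\ell\in\{0,\dots,q-1\},$$ and, for the same partitions, $$H\big(U^{(0)}_{[1:J_0]},\dots,U^{(q-1)}_{[1:J_{q-1}]}\big)\le 12q+\tfrac52\sum_{\ell=0}^{q-1}\log(1+\theta_\ell).$$ In particular both bounds are independent of $M$. -/

import Mathlib

open MeasureTheory ProbabilityTheory

/-- Shannon entropy in bits, `H(X) = -∑ₓ P(X = x) log₂ P(X = x)` with `0 log 0 = 0`, of a discrete
random variable `X`. It is used below only for random variables that take finitely many values,
so that the sum has finitely many nonzero terms. -/
noncomputable def shannonEntropy {Ω α : Type*} [MeasurableSpace Ω] (P : Measure Ω) (X : Ω → α) :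
    ℝ :=
  ∑' x : α, -(P.real (X ⁻¹' {x}) * Real.logb 2 (P.real (X ⁻¹' {x})))

/-- The (ordered) groups `A 0, …, A (J - 1)` form a partition of the set of the `M` sensors: they
are nonempty, cover all the sensors, and are pairwise disjoint. -/
structure IsGroupPartition {M J : ℕ} (A : Fin J → Finset (Fin M)) : Prop where
  nonempty : ∀ j, (A j).Nonempty
  cover : ∀ i, ∃ j, i ∈ A j
  disjoint : ∀ j k, j ≠ k → Disjoint (A j) (A k)

/-- The counter `U_m` of the recursion `U_0 = 0`,
`U_m = U_{m-1} + ∑_{i ∈ A_m} 1{U_{m-1} < θ and s_i = ℓ}` for `1 ≤ m ≤ J`, on the observations `s`.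
The groups `A_1, …, A_J` are `A 0, …, A (J - 1)`; the counter is constant after step `J`. -/
def counter {M q J : ℕ} (θ : ℕ) (A : Fin J → Finset (Fin M)) (l : Fin q) (s : Fin M → Fin q) :
    ℕ → ℕ
  | 0 => 0
  | m + 1 => counter θ A l s m +
      if h : m < J then
        ∑ i ∈ A ⟨m, h⟩, if counter θ A l s m < θ ∧ s i = l then 1 else 0
      else 0

/-- The tuple `(U_1, …, U_J)` of descriptions of the clipped frequency of `l`. -/
def descriptions {M q J : ℕ} (θ : ℕ) (A : Fin J → Finset (Fin M)) (l : Fin q)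
    (s : Fin M → Fin q) : Fin J → ℕ :=
  fun j => counter θ A l s (j + 1)

/-! For each `l`, group the sensors greedily so that the expected number of `l`'s in a group is at
most 2θ + 1, and at least 2θ except in the last group. Gibbs' inequality bounds the entropy of the
descriptions by their expected code length under any subprobability. The reference chosen is a
Markov chain with geometric increments of mean 2θ + 1, frozen from θ on (`geomKernel`). An unfrozen
step then costs on average at most log(1+θ) + 5/2 bits, weighted by the probability of reaching it
unfrozen; a frozen step costs nothing. An exponential Markov inequality bounds the probability that
the counter is still below θ after m ≥ 1 heavy groups by 2e^{-m}, so the expected number of unfrozen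
steps is at most 5/2, whatever M is (`expectation_indicator_le`, `sum_survivalBound_le`). Each
entropy is thus at most (5/2) log(1+θ) + 25/4. For the joint entropy, the product of the reference
chains serves in Gibbs' inequality, and code lengths add. -/

/-! ### Greedy grouping of the sensors -/

section Partition

/-- A finite family of weights in `[0, 1]` of total at least `t` has a nonempty subfamily of total
in `[t, t + 1]`. -/
lemma exists_subset_sum_mem_Icc {ι : Type*} [DecidableEq ι] (p : ι → ℝ) (hp1 : ∀ i, p i ≤ 1)
    {t : ℝ} (ht : 0 ≤ t) (s : Finset ι) (hs : s.Nonempty) (hts : t ≤ ∑ i ∈ s, p i) :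
    ∃ B ⊆ s, B.Nonempty ∧ t ≤ ∑ i ∈ B, p i ∧ ∑ i ∈ B, p i ≤ t + 1 := by
  induction s using Finset.strongInduction with
  | H s ih =>
    by_cases h : ∑ i ∈ s, p i ≤ t + 1
    · exact ⟨s, subset_rfl, hs, hts, h⟩
    · push Not at h
      -- The total exceeds `t + 1` and each weight is at most 1, so any element can be dropped.
      obtain ⟨i, hi⟩ := hs
      have hsum := Finset.add_sum_erase s p hi
      have hi1 := hp1 i
      have hpos : t < ∑ j ∈ s.erase i, p j := by linarith
      have hne : (s.erase i).Nonempty := by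
        rw [Finset.nonempty_iff_ne_empty]
        intro h0
        rw [h0, Finset.sum_empty] at hpos
        linarith
      obtain ⟨B, hB, hB'⟩ := ih _ (Finset.erase_ssubset hi) hne hpos.le
      exact ⟨B, hB.trans (Finset.erase_subset _ _), hB'⟩

/-- Greedy grouping: weights in `[0, 1]` can be grouped so that all the groups have total at most
`t + 1` and all but the last one have total at least `t`. -/
lemma exists_groups {ι : Type*} [DecidableEq ι] (p : ι → ℝ) (hp1 : ∀ i, p i ≤ 1)
    {t : ℝ} (ht : 0 ≤ t) (s : Finset ι) :
    ∃ (J : ℕ) (A : Fin J → Finset ι), (∀ j, (A j).Nonempty) ∧ (∀ i, i ∈ s ↔ ∃ j, i ∈ A j) ∧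
      (∀ j k, j ≠ k → Disjoint (A j) (A k)) ∧ (∀ j, ∑ i ∈ A j, p i ≤ t + 1) ∧
      ∀ j : Fin J, (j : ℕ) + 1 < J → t ≤ ∑ i ∈ A j, p i := by
  induction s using Finset.strongInduction with
  | H s ih =>
    rcases s.eq_empty_or_nonempty with rfl | hs
    · exact ⟨0, Fin.elim0, fun j => j.elim0, by simp, fun j => j.elim0, fun j => j.elim0,
        fun j => j.elim0⟩
    by_cases hts : t ≤ ∑ i ∈ s, p i
    · obtain ⟨B, hBs, hB, htB, hBt⟩ := exists_subset_sum_mem_Icc p hp1 ht s hs hts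
      obtain ⟨J, A, hne, hcov, hdis, hle, hge⟩ := ih _ (Finset.sdiff_ssubset hBs hB)
      have hBA : ∀ j, Disjoint B (A j) := fun j => by
        rw [Finset.disjoint_left]
        intro i hi hij
        exact (Finset.mem_sdiff.1 ((hcov i).2 ⟨j, hij⟩)).2 hi
      refine ⟨J + 1, Fin.cons B A, ?_, ?_, ?_, ?_, ?_⟩
      · intro j
        refine Fin.cases ?_ (fun j => ?_) j <;> simp [hB, hne]
      · intro i
        have := hcov i
        rw [Finset.mem_sdiff] at this
        simp only [Fin.exists_fin_succ, Fin.cons_zero, Fin.cons_succ, ← this]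
        have := @hBs i
        tauto
      · intro j k
        refine Fin.cases ?_ (fun j => ?_) j <;> refine Fin.cases ?_ (fun k => ?_) k
        · simp
        · simpa using fun _ => hBA k
        · simpa using (hBA j).symm
        · simpa using fun h => hdis j k h
      · intro j
        refine Fin.cases ?_ (fun j => ?_) j
        · simpa using hBt
        · simpa using hle j
      · intro j
        refine Fin.cases ?_ (fun j => ?_) j
        · simpa using fun _ => htB
        · simpa using hge j
    -- The remainder weighs less than `t` and becomes the last group, the only one allowed to be
    -- light.
    · refine ⟨1, fun _ => s, fun _ => hs, by simp, fun j k h => absurd (Subsingleton.elim j k) h,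
        fun _ => by linarith, fun j hj => ?_⟩
      omega

end Partition

/-! ### Gibbs' inequality and the reference Markov chain -/

section CrossEntropy

/-- Gibbs' inequality: the entropy of the image of a weight is at most its cross entropy with
respect to any subprobability weight. -/
lemma sum_neg_mul_logb_le_crossEntropy {σ α : Type*} [Fintype σ] [DecidableEq α] (w : σ → ℝ)
    (hw : ∀ s, 0 ≤ w s) (hw1 : ∑ s, w s = 1) (f : σ → α) (Q : α → ℝ) (hQ : ∀ s, 0 < Q (f s))
    (hQ1 : ∑ x ∈ Finset.univ.image f, Q x ≤ 1) :
    ∑ x ∈ Finset.univ.image f,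
        -((∑ s with f s = x, w s) * Real.logb 2 (∑ s with f s = x, w s)) ≤
      ∑ s, w s * -Real.logb 2 (Q (f s)) := by
  set W : α → ℝ := fun x => ∑ s with f s = x, w s with hW
  have hmaps : ∀ s ∈ (Finset.univ : Finset σ), f s ∈ Finset.univ.image f := fun s _ =>
    Finset.mem_image_of_mem f (Finset.mem_univ s)
  have hR : ∑ s, w s * -Real.logb 2 (Q (f s)) =
      ∑ x ∈ Finset.univ.image f, W x * -Real.logb 2 (Q x) := by
    rw [← Finset.sum_fiberwise_of_maps_to hmaps]
    refine Finset.sum_congr rfl fun x _ => ?_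
    rw [hW, Finset.sum_mul]
    refine Finset.sum_congr rfl fun s hs => ?_
    rw [(Finset.mem_filter.1 hs).2]
  have hS : ∑ x ∈ Finset.univ.image f, W x = 1 := by
    rw [← hw1, ← Finset.sum_fiberwise_of_maps_to hmaps]
  have h2 : 0 < Real.log 2 := Real.log_pos one_lt_two
  -- This is log y ≤ y - 1 at y = Q/W, multiplied by W; the right-hand sides sum to at most 0.
  have key : ∀ x ∈ Finset.univ.image f,
      -(W x * Real.logb 2 (W x)) - W x * -Real.logb 2 (Q x) ≤ (Q x - W x) / Real.log 2 := by
    intro x hx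
    obtain ⟨s, -, rfl⟩ := Finset.mem_image.1 hx
    have hq := hQ s
    have hW0 : 0 ≤ W (f s) := Finset.sum_nonneg fun s _ => hw s
    rcases hW0.eq_or_lt with h | h
    · rw [← h]
      simpa using (div_pos hq h2).le
    · have hlog := Real.log_le_sub_one_of_pos (div_pos hq h)
      rw [Real.log_div hq.ne' h.ne'] at hlog
      have := mul_le_mul_of_nonneg_left hlog h.le
      rw [mul_sub, mul_sub, mul_one, mul_div_cancel₀ _ h.ne'] at this
      rw [le_div_iff₀ h2]
      simp only [Real.logb]
      field_simp
      linarith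
  have := Finset.sum_le_sum key
  rw [Finset.sum_sub_distrib, ← Finset.sum_div, Finset.sum_sub_distrib, hS] at this
  have h3 : (∑ x ∈ Finset.univ.image f, Q x - 1) / Real.log 2 ≤ 0 :=
    div_nonpos_of_nonpos_of_nonneg (by linarith) h2.le
  rw [hR]
  linarith

/-- The weight of a path `x` started at `u` under the transition kernel `k`. -/
noncomputable def pathWeight (k : ℕ → ℕ → ℝ) {J : ℕ} (u : ℕ) (x : Fin J → ℕ) : ℝ :=
  ∏ m : Fin J, k (Fin.cons (α := fun _ => ℕ) u x m.castSucc) (x m)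

lemma pathWeight_cons (k : ℕ → ℕ → ℝ) {J : ℕ} (u y : ℕ) (x : Fin J → ℕ) :
    pathWeight k u (Fin.cons (α := fun _ => ℕ) y x) = k u y * pathWeight k y x := by
  simp [pathWeight, Fin.prod_univ_succ]

lemma pathWeight_nonneg {k : ℕ → ℕ → ℝ} (hk : ∀ u y, 0 ≤ k u y) {J : ℕ} (u : ℕ)
    (x : Fin J → ℕ) : 0 ≤ pathWeight k u x :=
  Finset.prod_nonneg fun _ _ => hk _ _

/-- Sum out the tail first: after the first step `y` it is a path of the same kernel started at `y`,
hence the induction over all `u`. -/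
lemma sum_piFinset_pathWeight_le_one {k : ℕ → ℕ → ℝ} (hk : ∀ u y, 0 ≤ k u y)
    (hk1 : ∀ u K, ∑ y ∈ Finset.range K, k u y ≤ 1) (K J : ℕ) (u : ℕ) :
    ∑ x ∈ Fintype.piFinset (fun _ : Fin J => Finset.range K), pathWeight k u x ≤ 1 := by
  induction J generalizing u with
  | zero => simp [pathWeight]
  | succ J ih =>
    have : ∑ x ∈ Fintype.piFinset (fun _ : Fin (J + 1) => Finset.range K), pathWeight k u x =
        ∑ z ∈ Finset.range K ×ˢ Fintype.piFinset (fun _ : Fin J => Finset.range K),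
          k u z.1 * pathWeight k z.1 z.2 := by
      refine (Finset.sum_equiv (Fin.consEquiv fun _ => ℕ) ?_ ?_).symm
      · rintro ⟨y, x⟩
        simp [Fin.consEquiv, Fin.forall_fin_succ]
      · rintro ⟨y, x⟩ -
        exact (pathWeight_cons k u y x).symm
    rw [this, Finset.sum_product]
    refine le_trans (Finset.sum_le_sum fun y _ => ?_) (hk1 u K)
    simp only [← Finset.mul_sum]
    exact mul_le_of_le_one_right (hk u y) (ih y)

/-- Any finite set of paths lies in a box, to which the previous bound applies. -/
lemma sum_pathWeight_le_one {k : ℕ → ℕ → ℝ} (hk : ∀ u y, 0 ≤ k u y)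
    (hk1 : ∀ u K, ∑ y ∈ Finset.range K, k u y ≤ 1) {J : ℕ} (u : ℕ) (T : Finset (Fin J → ℕ)) :
    ∑ x ∈ T, pathWeight k u x ≤ 1 := by
  refine le_trans (Finset.sum_le_sum_of_subset_of_nonneg
    (t := Fintype.piFinset fun _ => Finset.range (T.sup (fun x => ∑ j, x j) + 1)) ?_
    fun x _ _ => pathWeight_nonneg hk u x) (sum_piFinset_pathWeight_le_one hk hk1 _ J u)
  intro x hx
  rw [Fintype.mem_piFinset]
  intro j
  rw [Finset.mem_range, Nat.lt_succ_iff]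
  exact (Finset.single_le_sum (f := x) (fun _ _ => Nat.zero_le _) (Finset.mem_univ j)).trans
    (Finset.le_sup (f := fun x : Fin J → ℕ => ∑ j, x j) hx)

/-- The kernel with geometric increments of parameter `r` below `θ` and frozen from `θ` on. -/
noncomputable def geomKernel (θ : ℕ) (r : ℝ) (u y : ℕ) : ℝ :=
  if u < θ then if u ≤ y then (1 - r) * r ^ (y - u) else 0 else if y = u then 1 else 0

lemma geomKernel_nonneg (θ : ℕ) {r : ℝ} (h0 : 0 ≤ r) (h1 : r ≤ 1) (u y : ℕ) :
    0 ≤ geomKernel θ r u y := by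
  have := sub_nonneg.2 h1
  unfold geomKernel
  split_ifs <;> positivity

/-- Below `θ` the geometric sum telescopes to 1 - r^(K-u), truncated subtraction covering K ≤ u; a
frozen row is a point mass. -/
lemma sum_geomKernel_le_one (θ : ℕ) {r : ℝ} (h0 : 0 ≤ r) (u K : ℕ) :
    ∑ y ∈ Finset.range K, geomKernel θ r u y ≤ 1 := by
  by_cases hu : u < θ
  · have : ∑ y ∈ Finset.range K, geomKernel θ r u y = 1 - r ^ (K - u) := by
      induction K with
      | zero => simp
      | succ K ih =>
        rw [Finset.sum_range_succ, ih, geomKernel, if_pos hu]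
        split_ifs with h
        · rw [Nat.succ_sub h, pow_succ]
          ring
        · rw [Nat.sub_eq_zero_of_le (by omega : K ≤ u),
            Nat.sub_eq_zero_of_le (by omega : K + 1 ≤ u)]
          simp
    rw [this]
    have := pow_nonneg h0 (K - u)
    linarith
  · simp only [geomKernel, if_neg hu, Finset.sum_ite_eq']
    split_ifs <;> norm_num

end CrossEntropy

/-! ### Expectations under the product law -/

section Expectation

variable {M q : ℕ}

/-- The probability of the observations `s` under the product of the weights `π i`. -/
noncomputable def prodWeight (π : Fin M → Fin q → ℝ) (s : Fin M → Fin q) : ℝ :=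
  ∏ i, π i (s i)

lemma prodWeight_nonneg {π : Fin M → Fin q → ℝ} (h0 : ∀ i x, 0 ≤ π i x) (s : Fin M → Fin q) :
    0 ≤ prodWeight π s :=
  Finset.prod_nonneg fun _ _ => h0 _ _

lemma sum_prodWeight {π : Fin M → Fin q → ℝ} (h1 : ∀ i, ∑ x, π i x = 1) :
    ∑ s, prodWeight π s = 1 := by
  simp only [prodWeight]
  rw [← Fintype.piFinset_univ, ← Finset.prod_univ_sum]
  simp [h1]

/-- Independence: expectations of products over distinct sensors factor, and sensors outside `B`
contribute 1. -/
lemma sum_prodWeight_mul_prod {π : Fin M → Fin q → ℝ} (h1 : ∀ i, ∑ x, π i x = 1)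
    (B : Finset (Fin M)) (f : Fin M → Fin q → ℝ) :
    ∑ s, prodWeight π s * ∏ i ∈ B, f i (s i) = ∏ i ∈ B, ∑ x, π i x * f i x := by
  have h : ∀ s : Fin M → Fin q, prodWeight π s * ∏ i ∈ B, f i (s i) =
      ∏ i, π i (s i) * (if i ∈ B then f i (s i) else 1) := fun s => by
    rw [Finset.prod_mul_distrib, prodWeight, Finset.prod_ite_mem, Finset.univ_inter]
  simp only [h]
  rw [← Fintype.piFinset_univ, ← Finset.prod_univ_sum (fun _ => Finset.univ)
    (fun i x => π i x * (if i ∈ B then f i x else 1)), ← Finset.univ_inter B,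
    ← Finset.prod_ite_mem]
  refine Finset.prod_congr rfl fun i _ => ?_
  split_ifs <;> simp_all

/-- The entropy of a function of independent variables, as a finite sum. -/
lemma shannonEntropy_comp_eq_sum {Ω α : Type*} [MeasurableSpace Ω] [DecidableEq α]
    (P : Measure Ω) [IsProbabilityMeasure P] (p : Fin M → PMF (Fin q)) (S : Fin M → Ω → Fin q)
    (hS : ∀ i, Measurable (S i)) (hind : iIndepFun S P)
    (hlaw : ∀ i, P.map (S i) = (p i).toMeasure) (f : (Fin M → Fin q) → α) :
    shannonEntropy P (fun ω => f (fun i => S i ω)) =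
      ∑ x ∈ Finset.univ.image f,
        -((∑ s with f s = x, prodWeight (fun i y => (p i y).toReal) s) *
          Real.logb 2 (∑ s with f s = x, prodWeight (fun i y => (p i y).toReal) s)) := by
  have hpt : ∀ s : Fin M → Fin q, P.real ((fun ω i => S i ω) ⁻¹' {s}) =
      prodWeight (fun i y => (p i y).toReal) s := by
    intro s
    have hset : (fun ω i => S i ω) ⁻¹' {s} = ⋂ i ∈ Finset.univ, S i ⁻¹' {s i} := by
      ext ω
      simp [funext_iff]
    rw [measureReal_def, hset,
      hind.measure_inter_preimage_eq_mul Finset.univ (fun i _ => measurableSet_singleton (s i)),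
      ENNReal.toReal_prod, prodWeight]
    refine Finset.prod_congr rfl fun i _ => ?_
    rw [← Measure.map_apply (hS i) (measurableSet_singleton _), hlaw,
      PMF.toMeasure_apply_singleton _ _ (measurableSet_singleton _)]
  have hmeas : Measurable (fun ω i => S i ω) := measurable_pi_lambda _ hS
  have hpre : ∀ x, P.real ((fun ω => f (fun i => S i ω)) ⁻¹' {x}) =
      ∑ s with f s = x, prodWeight (fun i y => (p i y).toReal) s := by
    intro x
    have hset : (fun ω => f (fun i => S i ω)) ⁻¹' {x} =
        ⋃ s ∈ Finset.univ.filter (fun s => f s = x), (fun ω i => S i ω) ⁻¹' {s} := by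
      ext ω
      simp
    rw [hset, measureReal_biUnion_finset]
    · exact Finset.sum_congr rfl fun s _ => hpt s
    · intro s _ t _ hst
      exact Disjoint.preimage _ (Set.disjoint_singleton.2 hst)
    · exact fun s _ => hmeas (measurableSet_singleton s)
  unfold shannonEntropy
  simp only [hpre]
  refine tsum_eq_sum fun x hx => ?_
  have : (Finset.univ.filter fun s => f s = x) = ∅ := by
    rw [Finset.filter_eq_empty_iff]
    rintro s - rfl
    exact hx (Finset.mem_image_of_mem f (Finset.mem_univ s))
  rw [this]
  simp

end Expectation

/-! ### The counter, its survival and its code length -/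

section Counter

variable {M q J : ℕ}

/-- The union of the first `m` groups. -/
def firstGroups (A : Fin J → Finset (Fin M)) (m : ℕ) : Finset (Fin M) :=
  (Finset.univ.filter fun j : Fin J => (j : ℕ) < m).biUnion A

lemma firstGroups_succ (A : Fin J → Finset (Fin M)) (m : Fin J) :
    firstGroups A (m + 1) = A m ∪ firstGroups A m := by
  have : (Finset.univ.filter fun j : Fin J => (j : ℕ) < m + 1) =
      insert m (Finset.univ.filter fun j : Fin J => (j : ℕ) < m) := by
    ext j
    simp only [Finset.mem_filter, Finset.mem_univ, true_and, Finset.mem_insert, Fin.ext_iff]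
    omega
  rw [firstGroups, this, Finset.biUnion_insert, firstGroups]

lemma disjoint_firstGroups {A : Fin J → Finset (Fin M)}
    (hA : ∀ j k, j ≠ k → Disjoint (A j) (A k)) (m : Fin J) :
    Disjoint (A m) (firstGroups A m) := by
  rw [firstGroups, Finset.disjoint_biUnion_right]
  intro j hj
  refine hA m j ?_
  rintro rfl
  simp at hj

lemma counter_succ (θ : ℕ) (A : Fin J → Finset (Fin M)) (l : Fin q) (s : Fin M → Fin q)
    (m : Fin J) :
    counter θ A l s (m + 1) = counter θ A l s m +
      if counter θ A l s m < θ then ∑ i ∈ A m, if s i = l then 1 else 0 else 0 := by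
  rw [counter, dif_pos m.2]
  congr 1
  split_ifs with h <;> simp [h]

/-- A counter below the threshold has never been frozen. -/
lemma counter_eq_of_lt (θ : ℕ) {A : Fin J → Finset (Fin M)}
    (hA : ∀ j k, j ≠ k → Disjoint (A j) (A k)) (l : Fin q) (s : Fin M → Fin q) (m : ℕ)
    (hm : m ≤ J) (h : counter θ A l s m < θ) :
    counter θ A l s m = ∑ i ∈ firstGroups A m, if s i = l then 1 else 0 := by
  induction m with
  | zero => simp [counter, firstGroups]
  | succ m ih =>
    have e := counter_succ θ A l s ⟨m, hm⟩
    have e' := firstGroups_succ A ⟨m, hm⟩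
    have d := disjoint_firstGroups hA ⟨m, hm⟩
    simp only at e e' d
    have hlt : counter θ A l s m < θ := by omega
    rw [e, e', if_pos hlt, ih (by omega) hlt, Finset.sum_union d, add_comm]

/-- Exponential Markov bound for the event that the counter is below the threshold. -/
lemma indicator_counter_lt_le (θ : ℕ) {A : Fin J → Finset (Fin M)}
    (hA : ∀ j k, j ≠ k → Disjoint (A j) (A k)) (l : Fin q) (s : Fin M → Fin q) (m : ℕ)
    (hm : m ≤ J) :
    (if counter θ A l s m < θ then (1 : ℝ) else 0) ≤
      2 ^ θ * ∏ i ∈ firstGroups A m, if s i = l then (1 / 2 : ℝ) else 1 := by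
  have hprod : (∏ i ∈ firstGroups A m, if s i = l then (1 / 2 : ℝ) else 1) =
      (1 / 2) ^ (∑ i ∈ firstGroups A m, if s i = l then 1 else 0) := by
    rw [← Finset.prod_pow_eq_pow_sum]
    refine Finset.prod_congr rfl fun i _ => ?_
    split_ifs <;> simp
  rw [hprod]
  split_ifs with h
  -- The unfrozen counter is the plain count N of `l`'s so far, and N < θ gives 2^θ · 2^{-N} ≥ 1.
  · rw [← counter_eq_of_lt θ hA l s m hm h, one_div, inv_pow, ← div_eq_mul_inv,
      one_le_div (by positivity)]
    exact pow_le_pow_right₀ one_le_two h.le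
  · positivity

/-- The code length of the descriptions for the kernel `geomKernel`. -/
lemma neg_logb_pathWeight_descriptions (θ : ℕ) {r : ℝ} (h0 : 0 < r) (h1 : r < 1)
    (A : Fin J → Finset (Fin M)) (l : Fin q) (s : Fin M → Fin q) :
    0 < pathWeight (geomKernel θ r) 0 (descriptions θ A l s) ∧
    -Real.logb 2 (pathWeight (geomKernel θ r) 0 (descriptions θ A l s)) =
      ∑ m : Fin J, (if counter θ A l s m < θ then (1 : ℝ) else 0) *
        (-Real.logb 2 (1 - r) + (∑ i ∈ A m, if s i = l then 1 else 0) * -Real.logb 2 r) := by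
  have hr : 0 < 1 - r := by linarith
  have hcons : ∀ m : Fin J, (Fin.cons (α := fun _ => ℕ) 0 (descriptions θ A l s) m.castSucc : ℕ) =
      counter θ A l s m := by
    rintro ⟨m, hm⟩
    cases m with
    | zero => rfl
    | succ m => rfl
  have hk : ∀ m : Fin J, geomKernel θ r (counter θ A l s m) (counter θ A l s (m + 1)) =
      if counter θ A l s m < θ then (1 - r) * r ^ (∑ i ∈ A m, if s i = l then 1 else 0) else 1 := by
    intro m
    rw [counter_succ]
    by_cases h : counter θ A l s m < θ
    · simp only [geomKernel, if_pos h, if_pos (Nat.le_add_right _ _), Nat.add_sub_cancel_left]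
    · simp [geomKernel, h]
  have hpos : ∀ m : Fin J, 0 < geomKernel θ r (counter θ A l s m) (counter θ A l s (m + 1)) := by
    intro m
    rw [hk]
    split_ifs <;> positivity
  have hQ : pathWeight (geomKernel θ r) 0 (descriptions θ A l s) =
      ∏ m : Fin J, geomKernel θ r (counter θ A l s m) (counter θ A l s (m + 1)) := by
    simp only [pathWeight, hcons]
    rfl
  rw [hQ]
  refine ⟨Finset.prod_pos fun m _ => hpos m, ?_⟩
  rw [Real.logb_prod _ _ fun m _ => (hpos m).ne', ← Finset.sum_neg_distrib]
  refine Finset.sum_congr rfl fun m _ => ?_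
  rw [hk]
  split_ifs with h
  · rw [Real.logb_mul hr.ne' (pow_pos h0 _).ne', Real.logb_pow]
    push_cast
    ring
  · simp

end Counter

/-! ### Expected code length -/

section Cost

variable {M q J : ℕ}

/-- An upper bound for the probability that the counter is below the threshold before step `m`. -/
noncomputable def survivalBound (m : ℕ) : ℝ := if m = 0 then 1 else 2 * Real.exp (-m)

lemma survivalBound_nonneg (m : ℕ) : 0 ≤ survivalBound m := by
  unfold survivalBound
  split_ifs <;> positivity

lemma sum_survivalBound_le (J : ℕ) : ∑ m : Fin J, survivalBound m ≤ 5 / 2 := by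
  have he : Real.exp (-1) ≤ 2 / 5 := by
    rw [Real.exp_neg, inv_le_comm₀ (Real.exp_pos _) (by norm_num)]
    have := Real.exp_one_gt_d9
    linarith
  rw [Fin.sum_univ_eq_sum_range survivalBound]
  -- The constant c = 4/3 solves c(1 - x) = 2x at x = 2/5, the bound on 1/e, which closes the
  -- induction.
  have key : ∀ n, ∑ m ∈ Finset.range (n + 1), survivalBound m ≤
      5 / 2 - 4 / 3 * Real.exp (-n) := by
    intro n
    induction n with
    | zero => norm_num [survivalBound]
    | succ n ih =>
      rw [Finset.sum_range_succ]
      have h : Real.exp (-((n + 1 : ℕ) : ℝ)) = Real.exp (-n) * Real.exp (-1) := by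
        rw [← Real.exp_add]
        push_cast
        ring_nf
      have h2 : survivalBound (n + 1) = 2 * Real.exp (-((n + 1 : ℕ) : ℝ)) := by
        simp [survivalBound]
      rw [h2, h]
      have := mul_le_mul_of_nonneg_left he (Real.exp_pos (-(n : ℝ))).le
      linarith
  cases J with
  | zero => norm_num
  | succ n =>
    have := key n
    have := Real.exp_pos (-(n : ℝ))
    linarith

lemma sum_mul_ite_half {π : Fin q → ℝ} (h1 : ∑ x, π x = 1) (l : Fin q) :
    ∑ x, π x * (if x = l then (1 / 2 : ℝ) else 1) = 1 - π l / 2 := by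
  have : ∀ x, π x * (if x = l then (1 / 2 : ℝ) else 1) = π x - if x = l then π x / 2 else 0 := by
    intro x
    split_ifs <;> ring
  simp only [this, Finset.sum_sub_distrib, h1, Finset.sum_ite_eq', Finset.mem_univ, if_true]

lemma prod_one_sub_half_le {π : Fin M → Fin q → ℝ} (h0 : ∀ i x, 0 ≤ π i x)
    (h1 : ∀ i, ∑ x, π i x = 1) (l : Fin q) (B : Finset (Fin M)) :
    0 ≤ ∏ i ∈ B, (1 - π i l / 2) ∧
      ∏ i ∈ B, (1 - π i l / 2) ≤ Real.exp (-(∑ i ∈ B, π i l) / 2) := by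
  have hle : ∀ i, π i l ≤ 1 := fun i => by
    rw [← h1 i]
    exact Finset.single_le_sum (fun x _ => h0 i x) (Finset.mem_univ l)
  have hnn : ∀ i, 0 ≤ 1 - π i l / 2 := fun i => by linarith [hle i]
  refine ⟨Finset.prod_nonneg fun i _ => hnn i, ?_⟩
  rw [neg_div, Finset.sum_div, ← Finset.sum_neg_distrib, Real.exp_sum]
  refine Finset.prod_le_prod (fun i _ => hnn i) fun i _ => ?_
  linarith [Real.add_one_le_exp (-(π i l / 2))]

/-- As m < J, none of the first `m` groups is the last one, so all are heavy. -/
lemma le_sum_firstGroups {A : Fin J → Finset (Fin M)}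
    (hA : ∀ j k, j ≠ k → Disjoint (A j) (A k)) {c : Fin M → ℝ} {t : ℝ}
    (hge : ∀ j : Fin J, (j : ℕ) + 1 < J → t ≤ ∑ i ∈ A j, c i) (m : ℕ) (hm : m < J) :
    m * t ≤ ∑ i ∈ firstGroups A m, c i := by
  induction m with
  | zero => simp [firstGroups]
  | succ m ih =>
    have e := firstGroups_succ A ⟨m, by omega⟩
    have d := disjoint_firstGroups hA ⟨m, by omega⟩
    simp only at e d
    rw [e, Finset.sum_union d]
    have h1 := hge ⟨m, by omega⟩ hm
    have h2 := ih (by omega)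
    push_cast
    linarith

/-- The earlier groups weigh at least 2mθ, so the product is at most e^{-mθ}. Since log 2 < 1 ≤ m
and θ ≥ 1, e^{θ(log 2 - m)} ≤ 2e^{-m}. -/
lemma two_pow_mul_prod_le_survivalBound {π : Fin M → Fin q → ℝ} (h0 : ∀ i x, 0 ≤ π i x)
    (h1 : ∀ i, ∑ x, π i x = 1) {θ : ℕ} (hθ : 0 < θ) (l : Fin q) {A : Fin J → Finset (Fin M)}
    (hA : ∀ j k, j ≠ k → Disjoint (A j) (A k))
    (hge : ∀ j : Fin J, (j : ℕ) + 1 < J → 2 * (θ : ℝ) ≤ ∑ i ∈ A j, π i l) (m : Fin J)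
    (hm : (m : ℕ) ≠ 0) :
    2 ^ θ * ∏ i ∈ firstGroups A m, (1 - π i l / 2) ≤ survivalBound m := by
  have hsum := le_sum_firstGroups hA hge m m.2
  have hmR : (1 : ℝ) ≤ (m : ℕ) := by exact_mod_cast Nat.one_le_iff_ne_zero.2 hm
  have hθR : (1 : ℝ) ≤ θ := by exact_mod_cast hθ
  have hpow : (2 : ℝ) ^ θ = Real.exp (θ * Real.log 2) := by
    rw [Real.exp_nat_mul, Real.exp_log two_pos]
  have hl2 := Real.log_two_lt_d9
  calc 2 ^ θ * ∏ i ∈ firstGroups A m, (1 - π i l / 2)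
      ≤ 2 ^ θ * Real.exp (-(∑ i ∈ firstGroups A m, π i l) / 2) :=
        mul_le_mul_of_nonneg_left (prod_one_sub_half_le h0 h1 l _).2 (by positivity)
    _ ≤ 2 ^ θ * Real.exp (-((m : ℕ) * θ)) := by
        refine mul_le_mul_of_nonneg_left (Real.exp_le_exp.2 ?_) (by positivity)
        linarith
    _ = Real.exp (θ * (Real.log 2 - (m : ℕ))) := by
        rw [hpow, ← Real.exp_add]
        ring_nf
    _ ≤ Real.exp (Real.log 2 - (m : ℕ)) := Real.exp_le_exp.2 (by nlinarith)
    _ = survivalBound m := by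
        rw [Real.exp_sub, Real.exp_log two_pos, survivalBound, if_neg hm, Real.exp_neg]
        rfl

/-- The first two moments involving the event that step `m` is reached unfrozen. -/
lemma expectation_indicator_le {π : Fin M → Fin q → ℝ} (h0 : ∀ i x, 0 ≤ π i x)
    (h1 : ∀ i, ∑ x, π i x = 1) {θ : ℕ} (hθ : 0 < θ) (l : Fin q) {A : Fin J → Finset (Fin M)}
    (hA : ∀ j k, j ≠ k → Disjoint (A j) (A k))
    (hge : ∀ j : Fin J, (j : ℕ) + 1 < J → 2 * (θ : ℝ) ≤ ∑ i ∈ A j, π i l) (m : Fin J) :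
    ∑ s, prodWeight π s * (if counter θ A l s m < θ then (1 : ℝ) else 0) ≤ survivalBound m ∧
    ∀ i ∈ A m, ∑ s, prodWeight π s * ((if counter θ A l s m < θ then (1 : ℝ) else 0) *
      (if s i = l then 1 else 0)) ≤ survivalBound m * π i l := by
  have hmean : ∀ i, ∑ x, π i x * (if x = l then (1 : ℝ) else 0) = π i l := fun i => by simp
  by_cases hm : (m : ℕ) = 0
  · have hsb : survivalBound m = 1 := by simp [survivalBound, hm]
    have hle : ∀ s, (if counter θ A l s m < θ then (1 : ℝ) else 0) ≤ 1 := fun s => by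
      split_ifs <;> norm_num
    rw [hsb]
    refine ⟨?_, fun i _ => ?_⟩
    · exact (Finset.sum_le_sum fun s _ =>
        mul_le_of_le_one_right (prodWeight_nonneg h0 s) (hle s)).trans (sum_prodWeight h1).le
    · rw [one_mul]
      calc _ ≤ ∑ s, prodWeight π s * ∏ j ∈ {i}, (if s j = l then (1 : ℝ) else 0) := by
            refine Finset.sum_le_sum fun s _ =>
              mul_le_mul_of_nonneg_left ?_ (prodWeight_nonneg h0 s)
            rw [Finset.prod_singleton]
            exact mul_le_of_le_one_left (by split_ifs <;> norm_num) (hle s)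
        _ = π i l := by
            rw [sum_prodWeight_mul_prod h1 {i} (fun _ x => if x = l then (1 : ℝ) else 0),
              Finset.prod_singleton, hmean]
  · have hsb := two_pow_mul_prod_le_survivalBound h0 h1 hθ l hA hge m hm
    have hind := fun s : Fin M → Fin q => indicator_counter_lt_le θ hA l s m m.2.le
    refine ⟨?_, fun i hi => ?_⟩
    · calc _ ≤ ∑ s, 2 ^ θ * (prodWeight π s *
            ∏ j ∈ firstGroups A m, (if s j = l then (1 / 2 : ℝ) else 1)) := by
            refine Finset.sum_le_sum fun s _ => ?_
            rw [mul_left_comm]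
            exact mul_le_mul_of_nonneg_left (hind s) (prodWeight_nonneg h0 s)
        _ = 2 ^ θ * ∏ j ∈ firstGroups A m, (1 - π j l / 2) := by
            rw [← Finset.mul_sum, sum_prodWeight_mul_prod h1 (firstGroups A m)
              (fun _ x => if x = l then (1 / 2 : ℝ) else 1)]
            simp only [sum_mul_ite_half (h1 _)]
        _ ≤ survivalBound m := hsb
    · have hiB : i ∉ firstGroups A m :=
        Finset.disjoint_left.1 (disjoint_firstGroups hA m) hi
      have hne : ∀ j ∈ firstGroups A m, j ≠ i := by
        rintro j hj rfl
        exact hiB hj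
      -- Sensor `i` lies outside the earlier groups, so its indicator is one more independent
      -- factor.
      set f : Fin M → Fin q → ℝ := fun j x =>
        if j = i then (if x = l then 1 else 0) else if x = l then 1 / 2 else 1 with hf
      calc _ ≤ ∑ s, 2 ^ θ * (prodWeight π s * ∏ j ∈ insert i (firstGroups A m), f j (s j)) := by
            refine Finset.sum_le_sum fun s _ => ?_
            rw [mul_left_comm (2 ^ θ)]
            refine mul_le_mul_of_nonneg_left ?_ (prodWeight_nonneg h0 s)
            have hprod : ∏ j ∈ firstGroups A m, f j (s j) =
                ∏ j ∈ firstGroups A m, if s j = l then (1 / 2 : ℝ) else 1 :=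
              Finset.prod_congr rfl fun j hj => by simp only [hf, if_neg (hne j hj)]
            rw [Finset.prod_insert hiB, hprod, mul_left_comm, mul_comm]
            simp only [hf, if_true]
            exact mul_le_mul_of_nonneg_left (hind s) (by split_ifs <;> norm_num)
        _ = (2 ^ θ * ∏ j ∈ firstGroups A m, (1 - π j l / 2)) * π i l := by
            have hprod : ∏ j ∈ firstGroups A m, ∑ x, π j x * f j x =
                ∏ j ∈ firstGroups A m, (1 - π j l / 2) :=
              Finset.prod_congr rfl fun j hj => by
                simp only [hf, if_neg (hne j hj), sum_mul_ite_half (h1 j)]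
            rw [← Finset.mul_sum, sum_prodWeight_mul_prod h1, Finset.prod_insert hiB, hprod]
            simp only [hf, if_true, hmean]
            ring
        _ ≤ survivalBound m * π i l := mul_le_mul_of_nonneg_right hsb (h0 i l)

/-- Since 1/r = 1 + 1/(2θ+1) and log(1+x) ≤ x, the left side is at most 1/ln 2 < 3/2. -/
lemma logb_ratio_mul_le (θ : ℕ) :
    (2 * (θ : ℝ) + 1) * -Real.logb 2 (1 - 1 / (2 * (1 + θ))) ≤ 3 / 2 := by
  have hθ : (0 : ℝ) ≤ θ := Nat.cast_nonneg θ
  have hμ : (0 : ℝ) < 2 * θ + 1 := by positivity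
  have hinv : (1 - 1 / (2 * (1 + (θ : ℝ))))= ((2 * (1 + (θ : ℝ))) / (2 * θ + 1))⁻¹ := by
    field_simp
    ring
  have h2 := Real.log_two_gt_d9
  have hl : Real.log ((2 * (1 + (θ : ℝ))) / (2 * θ + 1)) ≤ 1 / (2 * θ + 1) := by
    refine (Real.log_le_sub_one_of_pos (by positivity)).trans (le_of_eq ?_)
    field_simp
    ring
  rw [hinv, Real.logb_inv, neg_neg, Real.logb, ← mul_div_assoc, div_le_iff₀ (by linarith)]
  have := mul_le_mul_of_nonneg_left hl hμ.le
  rw [mul_one_div_cancel hμ.ne'] at this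
  linarith

/-- The expected code length of the descriptions. -/
lemma expectation_codeLength_le {π : Fin M → Fin q → ℝ} (h0 : ∀ i x, 0 ≤ π i x)
    (h1 : ∀ i, ∑ x, π i x = 1) (θ : ℕ) (l : Fin q) {A : Fin J → Finset (Fin M)}
    (hA : ∀ j k, j ≠ k → Disjoint (A j) (A k))
    (hle : ∀ j, ∑ i ∈ A j, π i l ≤ 2 * (θ : ℝ) + 1)
    (hge : ∀ j : Fin J, (j : ℕ) + 1 < J → 2 * (θ : ℝ) ≤ ∑ i ∈ A j, π i l) :
    ∑ s, prodWeight π s * -Real.logb 2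
      (pathWeight (geomKernel θ (1 - 1 / (2 * (1 + θ)))) 0 (descriptions θ A l s)) ≤
      5 / 2 * Real.logb 2 (1 + (θ : ℝ)) + 25 / 4 := by
  have hθ0 : (0 : ℝ) ≤ θ := Nat.cast_nonneg θ
  -- Chosen so that the geometric mean r/(1-r) equals 2θ + 1, the cap on a group's weight.
  set r : ℝ := 1 - 1 / (2 * (1 + (θ : ℝ))) with hr
  have hfr : 1 / (2 * (1 + (θ : ℝ))) ≤ 1 / 2 := by
    apply one_div_le_one_div_of_le <;> linarith
  have hfr0 : 0 < 1 / (2 * (1 + (θ : ℝ))) := by positivity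
  have hr0 : 0 < r := by linarith
  have hr1 : r < 1 := by linarith
  have hL : 0 ≤ Real.logb 2 (1 + (θ : ℝ)) := Real.logb_nonneg one_lt_two (by linarith)
  have ha : -Real.logb 2 (1 - r) = 1 + Real.logb 2 (1 + (θ : ℝ)) := by
    rw [hr, sub_sub_cancel, one_div, Real.logb_inv, neg_neg,
      Real.logb_mul two_ne_zero (by positivity), Real.logb_self_eq_one one_lt_two]
  have hb : 0 ≤ -Real.logb 2 r :=
    neg_nonneg.2 (Real.logb_nonpos one_lt_two hr0.le hr1.le)
  have hμb : (2 * (θ : ℝ) + 1) * -Real.logb 2 r ≤ 3 / 2 := logb_ratio_mul_le θ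
  simp only [(neg_logb_pathWeight_descriptions θ hr0 hr1 A l _).2]
  set a := -Real.logb 2 (1 - r)
  set b := -Real.logb 2 r
  -- For θ = 0 the counter is frozen from the start and costs nothing; the survival bound needs θ ≥
  -- 1.
  rcases Nat.eq_zero_or_pos θ with rfl | hθ
  · norm_num
  · simp only [Finset.mul_sum]
    rw [Finset.sum_comm]
    have hstep : ∀ m : Fin J, ∑ s, prodWeight π s *
        ((if counter θ A l s m < θ then (1 : ℝ) else 0) *
          (a + (∑ i ∈ A m, if s i = l then 1 else 0) * b)) ≤ survivalBound m * (a + 3 / 2) := by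
      intro m
      obtain ⟨e1, e2⟩ := expectation_indicator_le h0 h1 hθ l hA hge m
      have hsplit : ∑ s, prodWeight π s *
          ((if counter θ A l s m < θ then (1 : ℝ) else 0) *
            (a + (∑ i ∈ A m, if s i = l then 1 else 0) * b)) =
          (∑ s, prodWeight π s * (if counter θ A l s m < θ then (1 : ℝ) else 0)) * a +
          (∑ i ∈ A m, ∑ s, prodWeight π s * ((if counter θ A l s m < θ then (1 : ℝ) else 0) *
            (if s i = l then 1 else 0))) * b := by
        rw [Finset.sum_comm, Finset.sum_mul, Finset.sum_mul, ← Finset.sum_add_distrib]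
        refine Finset.sum_congr rfl fun s _ => ?_
        rw [← Finset.mul_sum, ← Finset.mul_sum]
        ring
      rw [hsplit]
      have h3 : (∑ i ∈ A m, ∑ s, prodWeight π s *
          ((if counter θ A l s m < θ then (1 : ℝ) else 0) * (if s i = l then 1 else 0))) ≤
          survivalBound m * (2 * θ + 1) := by
        refine (Finset.sum_le_sum e2).trans ?_
        rw [← Finset.mul_sum]
        exact mul_le_mul_of_nonneg_left (hle m) (survivalBound_nonneg m)
      have h4 := mul_le_mul_of_nonneg_right h3 hb
      have h5 := mul_le_mul_of_nonneg_right e1 (show 0 ≤ a by rw [ha]; linarith)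
      have h6 := mul_le_mul_of_nonneg_left hμb (survivalBound_nonneg m)
      rw [← mul_assoc] at h6
      linarith
    refine (Finset.sum_le_sum fun m _ => hstep m).trans ?_
    rw [← Finset.sum_mul]
    refine (mul_le_mul_of_nonneg_right (sum_survivalBound_le J)
      (show 0 ≤ a + 3 / 2 by rw [ha]; linarith)).trans ?_
    rw [ha]
    linarith

end Cost

/-! ### The main theorem -/

theorem mainTheorem4 (M q : ℕ) (θ : Fin q → ℕ) (p : Fin M → PMF (Fin q)) :
    ∃ (J : Fin q → ℕ) (A : (l : Fin q) → Fin (J l) → Finset (Fin M)),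
      (∀ l, IsGroupPartition (A l)) ∧
      ∀ (Ω : Type*) [MeasurableSpace Ω] (P : Measure Ω) [IsProbabilityMeasure P]
        (S : Fin M → Ω → Fin q),
        (∀ i, Measurable (S i)) →
        iIndepFun S P →
        (∀ i, P.map (S i) = (p i).toMeasure) →
        (∀ l, shannonEntropy P (fun ω => descriptions (θ l) (A l) l (fun i => S i ω)) <
            5 / 2 * Real.logb 2 (1 + (θ l : ℝ)) + 12) ∧
        shannonEntropy P
            (fun ω => fun l : Fin q => descriptions (θ l) (A l) l (fun i => S i ω)) ≤
          12 * (q : ℝ) + 5 / 2 * ∑ l : Fin q, Real.logb 2 (1 + (θ l : ℝ)) := by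
  classical
  set π : Fin M → Fin q → ℝ := fun i y => (p i y).toReal with hπ
  have h0 : ∀ i x, 0 ≤ π i x := fun i x => ENNReal.toReal_nonneg
  have h1 : ∀ i, ∑ x, π i x = 1 := fun i => by
    rw [hπ, ← ENNReal.toReal_sum fun x _ => (p i).apply_ne_top x,
      ← tsum_fintype (L := .unconditional _), (p i).tsum_coe, ENNReal.toReal_one]
  have hπ1 : ∀ i l, π i l ≤ 1 := fun i l => by
    rw [← h1 i]
    exact Finset.single_le_sum (fun x _ => h0 i x) (Finset.mem_univ l)
  choose J A hne hcov hdis hle hge using fun l : Fin q =>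
    exists_groups (fun i => π i l) (fun i => hπ1 i l)
      (show (0 : ℝ) ≤ 2 * (θ l : ℝ) by positivity) Finset.univ
  refine ⟨J, A, fun l => ⟨hne l, fun i => (hcov l i).1 (Finset.mem_univ i), hdis l⟩, ?_⟩
  intro Ω _ P _ S hS hind hlaw
  have hcost := fun l => expectation_codeLength_le h0 h1 (θ l) l (hdis l) (hle l) (hge l)
  set r : Fin q → ℝ := fun l => 1 - 1 / (2 * (1 + (θ l : ℝ))) with hr
  have hr01 : ∀ l, 0 < r l ∧ r l < 1 := fun l => by
    have hθ0 : (0 : ℝ) ≤ θ l := Nat.cast_nonneg _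
    have hfr : 1 / (2 * (1 + (θ l : ℝ))) ≤ 1 / 2 := by
      apply one_div_le_one_div_of_le <;> linarith
    have hfr0 : 0 < 1 / (2 * (1 + (θ l : ℝ))) := by positivity
    constructor <;> simp only [hr] <;> linarith
  have hpos : ∀ l s, 0 < pathWeight (geomKernel (θ l) (r l)) 0 (descriptions (θ l) (A l) l s) :=
    fun l s => (neg_logb_pathWeight_descriptions (θ l) (hr01 l).1 (hr01 l).2 (A l) l s).1
  have hk : ∀ l u y, 0 ≤ geomKernel (θ l) (r l) u y := fun l =>
    geomKernel_nonneg (θ l) (hr01 l).1.le (hr01 l).2.le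
  have hsub : ∀ l (T : Finset (Fin (J l) → ℕ)),
      ∑ x ∈ T, pathWeight (geomKernel (θ l) (r l)) 0 x ≤ 1 := fun l T =>
    sum_pathWeight_le_one (hk l) (sum_geomKernel_le_one (θ l) (hr01 l).1.le) 0 T
  constructor
  · intro l
    rw [shannonEntropy_comp_eq_sum P p S hS hind hlaw (descriptions (θ l) (A l) l)]
    have := (sum_neg_mul_logb_le_crossEntropy (prodWeight π) (prodWeight_nonneg h0)
      (sum_prodWeight h1) (descriptions (θ l) (A l) l)
      (pathWeight (geomKernel (θ l) (r l)) 0) (hpos l) (hsub l _)).trans (hcost l)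
    linarith
  · rw [shannonEntropy_comp_eq_sum P p S hS hind hlaw
      (fun s => fun l : Fin q => descriptions (θ l) (A l) l s)]
    refine (sum_neg_mul_logb_le_crossEntropy (prodWeight π) (prodWeight_nonneg h0)
      (sum_prodWeight h1) (fun s => fun l : Fin q => descriptions (θ l) (A l) l s)
      (fun x => ∏ l, pathWeight (geomKernel (θ l) (r l)) 0 (x l))
      (fun s => Finset.prod_pos fun l _ => hpos l s) ?_).trans ?_
    · refine (Finset.sum_le_sum_of_subset_of_nonneg
        (t := Fintype.piFinset fun l => Finset.univ.image (descriptions (θ l) (A l) l)) ?_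
        fun x _ _ => Finset.prod_nonneg fun l _ => pathWeight_nonneg (hk l) 0 (x l)).trans ?_
      · intro x hx
        obtain ⟨s, -, rfl⟩ := Finset.mem_image.1 hx
        exact Fintype.mem_piFinset.2 fun l => Finset.mem_image_of_mem _ (Finset.mem_univ s)
      -- Over a product box, the total of the product reference factors into totals at most 1.
      · rw [← Finset.prod_univ_sum]
        exact Finset.prod_le_one
          (fun l _ => Finset.sum_nonneg fun x _ => pathWeight_nonneg (hk l) 0 x)
          fun l _ => hsub l _
    · have hlog : ∀ s, -Real.logb 2
          (∏ l, pathWeight (geomKernel (θ l) (r l)) 0 (descriptions (θ l) (A l) l s)) =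
          ∑ l, -Real.logb 2
            (pathWeight (geomKernel (θ l) (r l)) 0 (descriptions (θ l) (A l) l s)) := fun s => by
        rw [Real.logb_prod _ _ fun l _ => (hpos l s).ne', Finset.sum_neg_distrib]
      simp only [hlog, Finset.mul_sum]
      rw [Finset.sum_comm]
      refine (Finset.sum_le_sum fun l _ => hcost l).trans ?_
      rw [Finset.sum_add_distrib, ← Finset.mul_sum]
      have hq : (0 : ℝ) ≤ q := Nat.cast_nonneg q
      simp only [Finset.sum_const, Finset.card_univ, Fintype.card_fin, nsmul_eq_mul]
      linarith
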